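/- Let $\alpha\in\mathbb R$. For $i\in\mathbb N_0$ and $\beta\in\mathbb R$ put $$s_i(\beta)=(-1)^i\frac{\beta(\beta-1)\cdots(\beta-i+1)}{i!},$$ which equals $(-1)^i\dfrac{\Gamma(\beta+1)}{i!\,\Gamma(\beta-i+1)}$ whenever $\beta\notin\{-1,-2,\dots\}$ (with $1/\Gamma=0$ at the poles of $\Gamma$). For a complex sequence $x=(x_k)_{k\ge 0}$ let $(\Delta^{(\alpha)}x)_k=\sum_{i=0}^{k}s_i(\alpha)x_{k-i}$. Let $c_0(\Delta^{(\alpha)})$, $c(\Delta^{(\alpha)})$ and $\ell_\infty(\Delta^{(\alpha)})$ be the spaces of all complex sequences $x$ for which $\Delta^{(\alpha)}x$ is a null, convergent or bounded sequence, respectively, with the norm $\|x\|=\sup_k|(\Delta^{(\alpha)}x)_k|$. Let $A=(a_{nk})_{n,k\ge0}$ be an infinite complex matrix. For a sequence space $X$ write $A\in(X,\ell_1)$ if for every $x\in X$ all the series $A_nx=\sum_{k=0}^\infty a_{nk}x_k$ $(n\ge 0)$ converge and $Ax=(A_nx)_{n\ge0}\in\ell_1$; then $L_A:X\to\ell_1$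 is the operator $L_Ax=Ax$. Put $$\hat a_{nk}=\sum_{j=k}^\infty s_{j-k}(-\alpha)\,a_{nj},\qquad w^{(A_n)}_{mk}=\sum_{j=m}^\infty s_{j-k}(-\alpha)\,a_{nj}\quad(0\le k\le m),\qquad \gamma_n=\lim_{m\to\infty}\sum_{k=0}^m w^{(A_n)}_{mk}.$$ Infinite series are limits of partial sums. Below, $N_r$ runs over all finite subsets of $\{n\in\mathbb N_0: n\ge r\}$. (i) If $A\in(c_0(\Delta^{(\alpha)}),\ell_1)$ or $A\in(\ell_\infty(\Delta^{(\alpha)}),\ell_1)$, then all the series $\hat a_{nk}$ converge, and $L_A$ is compact if and only if $$\lim_{r\to\infty}\ \sup_{N_r}\ \sum_{k=0}^\infty\Bigl|\sum_{n\in N_r}\hat a_{nk}\Bigr|=0 .$$ (ii) If $A\in(c(\Delta^{(\alpha)}),\ell_1)$, then all the series $\hat a_{nk}$ converge, all the limits $\gamma_n$ exist, and $L_A$ is compact if and only if $$\lim_{r\to\infty}\ \sup_{N_r}\left(\sum_{k=0}^\infty\Bigl|\sum_{n\in N_r}\hat a_{nk}\Bigr|+\Bigl|\sum_{n\in N_r}\gamma_n\Bigr|\right)=0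 .$$ -/

import Mathlib

open Filter Topology Finset
open scoped ENNReal Nat

noncomputable section

namespace FracDiff

/-! ### The fractional difference matrix -/

/-- The coefficient `(-1)^i α (α - 1) ⋯ (α - i + 1) / i!` of `x_{k-i}` in the fractional
difference of order `α`. It equals `(-1)^i Γ(α + 1) / (i! Γ(α - i + 1))` whenever `Γ(α + 1)` is
defined; see `coeff_eq_gamma`. -/
def coeff (α : ℝ) (i : ℕ) : ℝ :=
  (-1) ^ i * (∏ l ∈ range i, (α - l)) / (i ! : ℝ)

theorem coeff_zero (α : ℝ) : coeff α 0 = 1 := by simp [coeff]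

/-- The Gamma quotient form. (At the poles of `Γ` in the denominator the quotient is read as `0`,
which is also what Mathlib's conventions `Γ(-m) = 0` and `x / 0 = 0` give.) -/
theorem coeff_eq_gamma (α : ℝ) (hα : ∀ m : ℕ, α + 1 ≠ -(m : ℝ)) (i : ℕ) :
    coeff α i = (-1) ^ i * Real.Gamma (α + 1) / ((i ! : ℝ) * Real.Gamma (α - i + 1)) := by
  have key : ∀ i : ℕ, (∏ l ∈ range i, (α - l)) = Real.Gamma (α + 1) / Real.Gamma (α - i + 1) := by
    intro i
    induction i with
    | zero => simp [div_self (Real.Gamma_ne_zero hα)]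
    | succ i ih =>
      rw [prod_range_succ, ih]
      have e : α - ((i + 1 : ℕ) : ℝ) + 1 = α - i := by push_cast; ring
      rw [e]
      by_cases h : α - i = 0
      · simp [h, Real.Gamma_zero]
      · rw [Real.Gamma_add_one h]
        field_simp
  rw [coeff, key i, mul_div_assoc, mul_div_assoc, div_div, mul_comm (Real.Gamma (α - i + 1))]

/-- The fractional difference matrix `Δ^(α)`. Its inverse is `Δ^(-α)`. -/
def diffMatrix (α : ℝ) : Matrix ℕ ℕ ℂ := fun n k =>
  if k ≤ n then (coeff α (n - k) : ℂ) else 0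

/-- The `Δ^(α)`-transform of a complex sequence `x`:
`y_n = ∑_{k ≤ n} Δ^(α)_{nk} x_k`, that is, `∑_i (coeff α i) x_{n-i}` with `x_j = 0` for `j < 0`. -/
def transform (α : ℝ) : (ℕ → ℂ) →ₗ[ℂ] (ℕ → ℂ) where
  toFun x := fun n => ∑ k ∈ range (n + 1), diffMatrix α n k * x k
  map_add' x y := by
    funext n
    simp [mul_add, sum_add_distrib]
  map_smul' c x := by
    funext n
    simp only [Pi.smul_apply, smul_eq_mul, RingHom.id_apply, mul_sum]
    exact sum_congr rfl fun k _ => by ring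

theorem transform_injective (α : ℝ) : Function.Injective (transform α) := by
  rw [← LinearMap.ker_eq_bot, LinearMap.ker_eq_bot']
  intro x hx
  funext n
  induction n using Nat.strong_induction_on with
  | _ n ih =>
    have h : ∑ k ∈ range (n + 1), diffMatrix α n k * x k = 0 := congrFun hx n
    rw [sum_range_succ, sum_eq_zero] at h
    · simpa [diffMatrix, coeff_zero] using h
    · intro k hk
      rw [ih k (mem_range.1 hk)]
      simp

/-! ### The sequence spaces -/

/-- The Banach space `ℓ_∞` of bounded complex sequences, with the supremum norm. -/
abbrev LInf : Type := lp (fun _ : ℕ => ℂ) ∞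

/-- The Banach space `ℓ_1` of absolutely summable complex sequences. -/
abbrev LOne : Type := lp (fun _ : ℕ => ℂ) 1

/-- `c_0` as a subspace of `ℓ_∞`. -/
def cZero : Submodule ℂ LInf where
  carrier := {y | Tendsto (fun n => y n) atTop (𝓝 0)}
  zero_mem' := by simp
  add_mem' {a b} ha hb := by simpa using Tendsto.add ha hb
  smul_mem' c a ha := by simpa using Tendsto.const_mul c ha

/-- `c` as a subspace of `ℓ_∞`. -/
def cConv : Submodule ℂ LInf where
  carrier := {y | ∃ l : ℂ, Tendsto (fun n => y n) atTop (𝓝 l)}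
  zero_mem' := ⟨0, by simp⟩
  add_mem' {a b} := by
    rintro ⟨l, hl⟩ ⟨m, hm⟩
    exact ⟨l + m, by simpa using hl.add hm⟩
  smul_mem' c a := by
    rintro ⟨l, hl⟩
    exact ⟨c * l, by simpa using hl.const_mul c⟩

/-- `ℓ_∞` as a subspace of itself. -/
def lInf : Submodule ℂ LInf := ⊤

/-- The matrix domain `E(Δ^(α)) = {x ∈ ω : Δ^(α) x ∈ E}` of `Δ^(α)` in `E ⊆ ℓ_∞`. -/
def domain (α : ℝ) (E : Submodule ℂ LInf) : Submodule ℂ (ℕ → ℂ) where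
  carrier := {x | ∃ y ∈ E, ⇑y = transform α x}
  zero_mem' := ⟨0, E.zero_mem, by rw [lp.coeFn_zero, map_zero]⟩
  add_mem' := by
    rintro a b ⟨y, hy, hya⟩ ⟨z, hz, hzb⟩
    exact ⟨y + z, E.add_mem hy hz, by rw [lp.coeFn_add, hya, hzb, map_add]⟩
  smul_mem' := by
    rintro c a ⟨y, hy, hya⟩
    exact ⟨c • y, E.smul_mem c hy, by rw [lp.coeFn_smul, hya, map_smul]⟩

theorem memℓp_infty_of_tendsto {y : ℕ → ℂ} {l : ℂ} (h : Tendsto y atTop (𝓝 l)) : Memℓp y ∞ :=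
  memℓp_infty h.norm.bddAbove_range

/-- `c_0(Δ^(α)) = {x : lim_k (Δ^(α) x)_k = 0}`. -/
theorem mem_domain_cZero {α : ℝ} {x : ℕ → ℂ} :
    x ∈ domain α cZero ↔ Tendsto (transform α x) atTop (𝓝 0) := by
  constructor
  · rintro ⟨y, hy, hyx⟩
    rw [← hyx]
    exact hy
  · intro h
    exact ⟨⟨transform α x, memℓp_infty_of_tendsto h⟩, h, rfl⟩

/-- `c(Δ^(α)) = {x : lim_k (Δ^(α) x)_k exists}`. -/
theorem mem_domain_cConv {α : ℝ} {x : ℕ → ℂ} :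
    x ∈ domain α cConv ↔ ∃ l, Tendsto (transform α x) atTop (𝓝 l) := by
  constructor
  · rintro ⟨y, hy, hyx⟩
    rw [← hyx]
    exact hy
  · rintro ⟨l, h⟩
    exact ⟨⟨transform α x, memℓp_infty_of_tendsto h⟩, ⟨l, h⟩, rfl⟩

/-- `ℓ_∞(Δ^(α)) = {x : sup_k |(Δ^(α) x)_k| < ∞}`. -/
theorem mem_domain_lInf {α : ℝ} {x : ℕ → ℂ} :
    x ∈ domain α lInf ↔ BddAbove (Set.range fun n => ‖transform α x n‖) := by
  constructor
  · rintro ⟨y, -, hyx⟩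
    rw [← hyx]
    exact (lp.memℓp y).bddAbove
  · intro h
    exact ⟨⟨transform α x, memℓp_infty h⟩, trivial, rfl⟩

/-- The space `E(Δ^(α))` as a type of its own, so that it carries the norm below and not the
topology of coordinatewise convergence inherited from `ℕ → ℂ`. -/
def Space (α : ℝ) (E : Submodule ℂ LInf) : Type := ↥(domain α E)

namespace Space

variable {α : ℝ} {E : Submodule ℂ LInf}

instance : AddCommGroup (Space α E) := inferInstanceAs (AddCommGroup ↥(domain α E))

instance : Module ℂ (Space α E) := inferInstanceAs (Module ℂ ↥(domain α E))

/-- The underlying sequence of an element of `E(Δ^(α))`. -/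
def seq : Space α E →ₗ[ℂ] (ℕ → ℂ) := (domain α E).subtype

theorem seq_injective : Function.Injective (seq : Space α E →ₗ[ℂ] (ℕ → ℂ)) :=
  Subtype.val_injective

theorem seq_mem (x : Space α E) : seq x ∈ domain α E := Subtype.property x

theorem memℓp_transform (x : Space α E) : Memℓp (transform α (seq x)) ∞ := by
  obtain ⟨y, -, hy⟩ := seq_mem x
  rw [← hy]
  exact lp.memℓp y

/-- The map `x ↦ Δ^(α) x` from `E(Δ^(α))` to `ℓ_∞`. -/
def toLInf : Space α E →ₗ[ℂ] LInf where
  toFun x := ⟨transform α (seq x), memℓp_transform x⟩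
  map_add' x y := by
    apply Subtype.ext
    simp only [map_add]
    rfl
  map_smul' c x := by
    apply Subtype.ext
    simp only [map_smul]
    rfl

theorem toLInf_apply (x : Space α E) : ⇑(toLInf x) = transform α (seq x) := rfl

theorem toLInf_injective : Function.Injective (toLInf : Space α E →ₗ[ℂ] LInf) := by
  intro x y h
  apply seq_injective
  apply transform_injective α
  rw [← toLInf_apply, ← toLInf_apply, h]

/-- The norm `‖x‖ = sup_n |(Δ^(α) x)_n|` of `E(Δ^(α))`; see `norm_eq`. -/
instance : NormedAddCommGroup (Space α E) :=
  NormedAddCommGroup.induced (Space α E) LInf toLInf toLInf_injective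

theorem norm_eq (x : Space α E) : ‖x‖ = ⨆ n, ‖transform α (seq x) n‖ :=
  lp.norm_eq_ciSup (toLInf x)

instance : NormedSpace ℂ (Space α E) := NormedSpace.induced ℂ (Space α E) LInf toLInf

end Space

/-! ### Matrix transformations

Infinite series are limits of their partial sums (`SummationFilter.conditional ℕ`); the convergence
need not be absolute. -/

/-- `A_n x = ∑_k a_{nk} x_k`, and `A x = (A_n x)_n`. -/
def apply (A : Matrix ℕ ℕ ℂ) (x : ℕ → ℂ) (n : ℕ) : ℂ :=
  ∑'[SummationFilter.conditional ℕ] k, A n k * x k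

/-- `A ∈ (X, ℓ_1)`: for each `x ∈ X` all the series `A_n x` converge, and `A x ∈ ℓ_1`. -/
def MapsToLOne (A : Matrix ℕ ℕ ℂ) (X : Submodule ℂ (ℕ → ℂ)) : Prop :=
  ∀ x ∈ X, (∀ n, Summable (fun k => A n k * x k) (SummationFilter.conditional ℕ)) ∧
    Memℓp (apply A x) 1

/-- The operator `L_A : E(Δ^(α)) → ℓ_1`, `L_A x = A x`, of a matrix `A ∈ (E(Δ^(α)), ℓ_1)`. -/
def matrixOp {α : ℝ} {E : Submodule ℂ LInf} (A : Matrix ℕ ℕ ℂ)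
    (hA : MapsToLOne A (domain α E)) : Space α E →ₗ[ℂ] LOne where
  toFun x := ⟨apply A (Space.seq x), (hA _ (Space.seq_mem x)).2⟩
  map_add' x y := by
    apply Subtype.ext
    funext n
    have hx := (hA _ (Space.seq_mem x)).1 n
    have hy := (hA _ (Space.seq_mem y)).1 n
    simp only [map_add]
    change apply A (Space.seq x + Space.seq y) n = apply A (Space.seq x) n + apply A (Space.seq y) n
    simp only [apply, Pi.add_apply, mul_add]
    exact hx.tsum_add hy
  map_smul' c x := by
    apply Subtype.ext
    funext n
    have hx := (hA _ (Space.seq_mem x)).1 n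
    simp only [map_smul]
    change apply A (c • Space.seq x) n = c * apply A (Space.seq x) n
    simp only [apply, Pi.smul_apply, smul_eq_mul, mul_left_comm _ c]
    exact hx.tsum_mul_left c

/-- `â_{nk} = ∑_{j ≥ k} Δ^(-α)_{jk} a_{nj}` (the terms with `j < k` vanish). -/
def hat (α : ℝ) (A : Matrix ℕ ℕ ℂ) (n k : ℕ) : ℂ :=
  ∑'[SummationFilter.conditional ℕ] j, diffMatrix (-α) j k * A n j

/-- The triangle `w^{(A_n)}_{mk} = ∑_{j ≥ m} Δ^(-α)_{jk} a_{nj}` for `k ≤ m`, and `0` for `k > m`. -/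
def tail (α : ℝ) (A : Matrix ℕ ℕ ℂ) (n m k : ℕ) : ℂ :=
  if k ≤ m then
    ∑'[SummationFilter.conditional ℕ] j, if m ≤ j then diffMatrix (-α) j k * A n j else 0
  else 0

/-- `γ_n = lim_m ∑_{k=0}^m w^{(A_n)}_{mk}`. -/
def gam (α : ℝ) (A : Matrix ℕ ℕ ℂ) (n : ℕ) : ℂ :=
  limUnder atTop fun m => ∑ k ∈ range (m + 1), tail α A n m k

/-- All the series that define `â_{nk}` converge. The series that define `w^{(A_n)}_{mk}` are tails
of these. -/
def HatExists (α : ℝ) (A : Matrix ℕ ℕ ℂ) : Prop :=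
  ∀ n k, Summable (fun j => diffMatrix (-α) j k * A n j) (SummationFilter.conditional ℕ)

/-- All the limits that define `γ_n` exist. -/
def GamExists (α : ℝ) (A : Matrix ℕ ℕ ℂ) : Prop :=
  ∀ n, ∃ g : ℂ, Tendsto (fun m => ∑ k ∈ range (m + 1), tail α A n m k) atTop (𝓝 g)

/-- `∑_k |∑_{n ∈ N} â_{nk}|`, the `ℓ_1`-norm of `∑_{n ∈ N} Â_n`, as an element of `[0, ∞]`. -/
def hatSumNorm (α : ℝ) (A : Matrix ℕ ℕ ℂ) (N : Finset ℕ) : ℝ≥0∞ :=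
  ∑' k, ‖∑ n ∈ N, hat α A n k‖ₑ

end FracDiff

end

noncomputable section

namespace FracDiff

/-! ### Pointwise limits of triangular functionals -/

/-! Put `y = Δ^(α) x`. Since `Δ^(α)` has the triangular inverse `Δ^(-α)`, the space `E(Δ^(α))` is
isometric to `E`, and the partial sums of `A_n x` are functionals of `y` that read only finitely
many coordinates. Their values on unit vectors converge to `â_{nk}`. On `c₀`, Banach–Steinhaus gives
`â_n ∈ ℓ_1` and `A_n x = ∑_k â_{nk} y_k` (`summable_norm_limit_single`, `tendsto_sum_limit_single`).
On `ℓ_∞` the finitely supported sequences are not dense, and a Baire argument yields the same series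
(`exists_tail_bound`). On `c`, splitting off the limit `l` of `y` gives `A_n x = ∑_k â_{nk} y_k - l
γ_n` (`tendsto_sum_hat_of_tendsto`). Hence the norm of `∑_{n ∈ N} A_n` is `hatSumNorm α A N` in the
first two cases, and is equivalent to `hatSumNorm α A N + |∑_{n ∈ N} γ_n|` in the third. It remains
to see that an operator into `ℓ_1` is compact exactly when these norms are uniformly small for `N`
far out (`isCompactOperator_iff_tendsto`). Compact sets in `ℓ_1` have uniformly small tails;
conversely, bounds on all subset sums bound the absolute sums up to a factor 4, so the finite-rank
truncations converge in norm. -/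

theorem triangular_apply {g : (ℕ → ℂ) →ₗ[ℂ] ℂ} {M : ℕ}
    (hg : ∀ y z : ℕ → ℂ, (∀ k < M, y k = z k) → g y = g z) (y : ℕ → ℂ) :
    g y = ∑ k ∈ range M, y k * g (Pi.single k 1) := by
  rw [hg y (∑ k ∈ range M, y k • Pi.single k 1)]
  · simp
  · intro k hk
    simp [Finset.sum_apply, Pi.single_apply, hk]

/-- The coordinate functionals of `c₀`. -/
def zeroAtInftyEval (k : ℕ) : ZeroAtInftyContinuousMap ℕ ℂ →L[ℂ] ℂ :=
  LinearMap.mkContinuous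
    { toFun := fun u => u k
      map_add' := fun _ _ => rfl
      map_smul' := fun _ _ => rfl } 1 fun u => by
    rw [one_mul]
    exact u.toBCF.norm_coe_le_norm k

theorem zeroAtInftyEval_apply (k : ℕ) (u : ZeroAtInftyContinuousMap ℕ ℂ) :
    zeroAtInftyEval k u = u k := rfl

section Limits

variable {g : ℕ → (ℕ → ℂ) →ₗ[ℂ] ℂ} {f : (ℕ → ℂ) → ℂ}

/-- A form of the Banach–Steinhaus theorem on `c₀`. -/
theorem exists_bound_of_tendsto
    (hg : ∀ M (y z : ℕ → ℂ), (∀ k < M, y k = z k) → g M y = g M z)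
    (hf : ∀ y, Tendsto y atTop (𝓝 0) → Tendsto (fun M => g M y) atTop (𝓝 (f y))) :
    ∃ C : ℝ, 0 ≤ C ∧ ∀ y, Tendsto y atTop (𝓝 0) → ∀ B, (∀ k, ‖y k‖ ≤ B) → ‖f y‖ ≤ C * B := by
  let G : ℕ → ZeroAtInftyContinuousMap ℕ ℂ →L[ℂ] ℂ := fun M =>
    ∑ k ∈ range M, g M (Pi.single k 1) • zeroAtInftyEval k
  have hG : ∀ M (u : ZeroAtInftyContinuousMap ℕ ℂ), G M u = g M u := by
    intro M u
    rw [triangular_apply (hg M) u]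
    simp [G, zeroAtInftyEval_apply, mul_comm]
  have hu : ∀ u : ZeroAtInftyContinuousMap ℕ ℂ, Tendsto (u : ℕ → ℂ) atTop (𝓝 0) := by
    intro u
    have := u.zero_at_infty'
    rwa [cocompact_eq_cofinite, Nat.cofinite_eq_atTop] at this
  have h : Tendsto (fun M u => G M u) atTop (𝓝 fun u : ZeroAtInftyContinuousMap ℕ ℂ => f u) := by
    refine tendsto_pi_nhds.2 fun u => ?_
    simp only [hG]
    exact hf u (hu u)
  let T := continuousLinearMapOfTendsto G h
  refine ⟨‖T‖, T.opNorm_nonneg, fun y hy B hB => ?_⟩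
  let u : ZeroAtInftyContinuousMap ℕ ℂ :=
    ⟨⟨y, continuous_of_discreteTopology⟩, by rwa [cocompact_eq_cofinite, Nat.cofinite_eq_atTop]⟩
  have hn : ‖u‖ ≤ B :=
    (BoundedContinuousFunction.norm_le ((norm_nonneg _).trans (hB 0))).2 hB
  calc ‖f y‖ = ‖T u‖ := rfl
    _ ≤ ‖T‖ * ‖u‖ := T.le_opNorm u
    _ ≤ ‖T‖ * B := by gcongr

/-- The initial segment of length `L` of a sequence, continued by zeros. -/
def head (L : ℕ) (y : ℕ → ℂ) : ℕ → ℂ := fun k => if k < L then y k else 0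

theorem tendsto_head (L : ℕ) (y : ℕ → ℂ) : Tendsto (head L y) atTop (𝓝 0) := by
  refine tendsto_const_nhds.congr' ?_
  filter_upwards [eventually_ge_atTop L] with k hk
  simp [head, hk.not_gt]

theorem norm_head_le {L : ℕ} {y : ℕ → ℂ} {B : ℝ} (hB : ∀ k, ‖y k‖ ≤ B) (k : ℕ) :
    ‖head L y k‖ ≤ B := by
  unfold head
  split_ifs
  · exact hB k
  · simpa using (norm_nonneg _).trans (hB k)

theorem head_eq_sum (L : ℕ) (y : ℕ → ℂ) :
    head L y = ∑ k ∈ range L, y k • Pi.single (M := fun _ => ℂ) k 1 := by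
  funext k
  simp [head, Finset.sum_apply, Pi.single_apply]

theorem tendsto_single (k : ℕ) :
    Tendsto (Pi.single (M := fun _ => ℂ) k 1) atTop (𝓝 0) := by
  refine tendsto_const_nhds.congr' ?_
  filter_upwards [eventually_gt_atTop k] with j hj
  simp [hj.ne']

/-- The limit `f` is not assumed linear; on finite sequences linearity is inherited from the `g M`
by uniqueness of limits. -/
theorem limit_head
    (hf : ∀ y, Tendsto y atTop (𝓝 0) → Tendsto (fun M => g M y) atTop (𝓝 (f y)))
    (L : ℕ) (y : ℕ → ℂ) : f (head L y) = ∑ k ∈ range L, f (Pi.single k 1) * y k := by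
  refine tendsto_nhds_unique (hf _ (tendsto_head L y)) ?_
  simp only [head_eq_sum, map_sum, map_smul, smul_eq_mul, mul_comm (y _)]
  exact tendsto_finsetSum _ fun k _ => (hf _ (tendsto_single k)).mul_const _

/-- Test the uniform bound on initial segments of the unimodular sequence that rotates each `f
(Pi.single k 1)` to its modulus. -/
theorem summable_norm_limit_single
    (hg : ∀ M (y z : ℕ → ℂ), (∀ k < M, y k = z k) → g M y = g M z)
    (hf : ∀ y, Tendsto y atTop (𝓝 0) → Tendsto (fun M => g M y) atTop (𝓝 (f y))) :
    Summable fun k => ‖f (Pi.single k 1)‖ := by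
  obtain ⟨C, -, hC⟩ := exists_bound_of_tendsto hg hf
  choose u hu hfu using fun k => RCLike.exists_norm_eq_mul_self (f (Pi.single k 1))
  refine summable_of_sum_range_le (c := C * 1) (fun _ => norm_nonneg _) fun L => ?_
  have h := hC _ (tendsto_head L u) 1 (norm_head_le fun k => (hu k).le)
  rw [limit_head hf] at h
  simp only [mul_comm _ (u _), ← hfu] at h
  refine le_trans (le_of_eq ?_) h
  have h0 : 0 ≤ ∑ k ∈ range L, ‖f (Pi.single k 1)‖ := sum_nonneg fun _ _ => norm_nonneg _
  rw [← Real.norm_of_nonneg h0, ← Complex.norm_real, Complex.ofReal_sum]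
  rfl

/-- The remainder `y - head L y` is small in supremum norm because `y` is null, so the bound on `f`
applies to it. -/
theorem tendsto_sum_limit_single
    (hg : ∀ M (y z : ℕ → ℂ), (∀ k < M, y k = z k) → g M y = g M z)
    (hf : ∀ y, Tendsto y atTop (𝓝 0) → Tendsto (fun M => g M y) atTop (𝓝 (f y)))
    {y : ℕ → ℂ} (hy : Tendsto y atTop (𝓝 0)) :
    Tendsto (fun L => ∑ k ∈ range L, f (Pi.single k 1) * y k) atTop (𝓝 (f y)) := by
  obtain ⟨C, hC0, hC⟩ := exists_bound_of_tendsto hg hf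
  rw [Metric.tendsto_atTop]
  intro ε hε
  obtain ⟨L₀, hL₀⟩ := Metric.tendsto_atTop.1 hy (ε / (C + 1)) (by positivity)
  refine ⟨L₀, fun L hL => ?_⟩
  have hz : Tendsto (y - head L y) atTop (𝓝 0) := by
    have h := hy.sub (tendsto_head L y)
    rwa [sub_zero] at h
  have hsub : f (y - head L y) = f y - f (head L y) := by
    refine tendsto_nhds_unique (hf _ hz) ?_
    simp only [map_sub]
    exact (hf _ hy).sub (hf _ (tendsto_head L y))
  have hb := hC _ hz (ε / (C + 1)) fun k => by
    by_cases hk : k < L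
    · simpa [head, hk] using (by positivity : 0 ≤ ε / (C + 1))
    · simpa [head, hk] using (hL₀ k (hL.trans (not_lt.1 hk))).le
  rw [hsub, limit_head hf] at hb
  rw [dist_comm, dist_eq_norm]
  refine hb.trans_lt ?_
  rw [← mul_div_assoc, div_lt_iff₀ (by positivity)]
  nlinarith

/-- Triangular functionals that converge at each bounded sequence are equicontinuous at the tails:
the Baire category argument behind Schur's theorem. -/
theorem exists_tail_bound
    (hg : ∀ M (y z : ℕ → ℂ), (∀ k < M, y k = z k) → g M y = g M z)
    (hf : ∀ y, (∃ B, ∀ k, ‖y k‖ ≤ B) → Tendsto (fun M => g M y) atTop (𝓝 (f y)))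
    {ε : ℝ} (hε : 0 < ε) :
    ∃ K, ∀ z : ℕ → ℂ, (∀ k, ‖z k‖ ≤ 1) → (∀ k < K, z k = 0) → ‖f z‖ ≤ 2 * ε := by
  -- The unit ball of `ℓ_∞` with the product topology is compact Hausdorff, hence Baire, and each `g
  -- M` is continuous on it because it reads finitely many coordinates.
  let Q := ℕ → Metric.closedBall (0 : ℂ) 1
  let F : ℕ → Set Q := fun m =>
    {y | ∀ M ≥ m, ∀ M' ≥ m, ‖g M (fun k => (y k : ℂ)) - g M' (fun k => (y k : ℂ))‖ ≤ ε}
  have hcont : ∀ M, Continuous fun y : Q => g M (fun k => (y k : ℂ)) := by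
    intro M
    have h : (fun y : Q => g M (fun k => (y k : ℂ))) =
        fun y : Q => ∑ k ∈ range M, (y k : ℂ) * g M (Pi.single k 1) :=
      funext fun y => triangular_apply (hg M) _
    rw [h]
    fun_prop
  have hclosed : ∀ m, IsClosed (F m) := by
    intro m
    simp only [F, Set.ofPred_forall]
    exact isClosed_iInter fun M => isClosed_iInter fun _ => isClosed_iInter fun M' =>
      isClosed_iInter fun _ => isClosed_le ((hcont M).sub (hcont M')).norm continuous_const
  have hcover : ⋃ m, F m = Set.univ := by
    refine Set.eq_univ_of_forall fun y => ?_
    have hy := hf (fun k => (y k : ℂ)) ⟨1, fun k => mem_closedBall_zero_iff.1 (y k).2⟩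
    obtain ⟨m, hm⟩ := Metric.cauchySeq_iff.1 hy.cauchySeq ε hε
    refine Set.mem_iUnion.2 ⟨m, fun M hM M' hM' => ?_⟩
    simpa [dist_eq_norm] using (hm M hM M' hM').le
  have : Nonempty Q := ⟨fun _ => ⟨0, by simp⟩⟩
  obtain ⟨m, p, hp⟩ := nonempty_interior_of_iUnion_of_closed hclosed hcover
  -- A basic neighbourhood of `p` constrains only finitely many coordinates; beyond them points of
  -- `F m` are arbitrary. Taking the maximum with `m` below also makes `g m z` vanish.
  obtain ⟨I, u, hu, hsub⟩ := isOpen_pi_iff.1 isOpen_interior p hp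
  obtain ⟨K₀, hK₀⟩ := I.exists_nat_subset_range
  refine ⟨max K₀ m, fun z hz hz0 => ?_⟩
  -- Two points of `F m` whose difference is `z`; each contributes one `ε`.
  let q : Q := fun k => if k < max K₀ m then p k else ⟨z k, by simpa using hz k⟩
  let q' : Q := fun k => if k < max K₀ m then p k else ⟨0, by simp⟩
  have hmem : ∀ r : Q, (∀ k < max K₀ m, r k = p k) → r ∈ F m := by
    intro r hr
    refine interior_subset (hsub fun k hk => ?_)
    rw [hr k (lt_max_of_lt_left (mem_range.1 (hK₀ hk)))]
    exact (hu k hk).2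
  have hq := hmem q fun k hk => by simp only [q, if_pos hk]
  have hq' := hmem q' fun k hk => by simp only [q', if_pos hk]
  have hqz : (fun k => (q k : ℂ)) - (fun k => (q' k : ℂ)) = z := by
    funext k
    by_cases hk : k < max K₀ m
    · simp only [Pi.sub_apply, q, q', if_pos hk, sub_self, hz0 k hk]
    · simp only [Pi.sub_apply, q, q', if_neg hk, sub_zero]
  have hgm : g m z = 0 := by
    rw [hg m z 0 fun k hk => hz0 k (lt_max_of_lt_right hk), map_zero]
  refine le_of_tendsto (hf z ⟨1, hz⟩).norm ?_
  filter_upwards [eventually_ge_atTop m] with M hM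
  have h1 := hq M hM m le_rfl
  have h2 := hq' M hM m le_rfl
  calc ‖g M z‖ = ‖g M z - g m z‖ := by rw [hgm, sub_zero]
    _ = ‖(g M (fun k => (q k : ℂ)) - g m (fun k => (q k : ℂ))) -
          (g M (fun k => (q' k : ℂ)) - g m (fun k => (q' k : ℂ)))‖ := by
        rw [← hqz, map_sub, map_sub]
        congr 1
        ring
    _ ≤ ε + ε := norm_sub_le_of_le h1 h2
    _ = 2 * ε := by ring

/-- The remainder `y - head L y` need not be small in norm, but it vanishes below `L`; rescaled into
the unit ball it falls under `exists_tail_bound`. Dividing by `B + 1` avoids the case `B = 0`. -/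
theorem tendsto_sum_limit_single_of_bounded
    (hg : ∀ M (y z : ℕ → ℂ), (∀ k < M, y k = z k) → g M y = g M z)
    (hf : ∀ y, (∃ B, ∀ k, ‖y k‖ ≤ B) → Tendsto (fun M => g M y) atTop (𝓝 (f y)))
    {y : ℕ → ℂ} {B : ℝ} (hy : ∀ k, ‖y k‖ ≤ B) :
    Tendsto (fun L => ∑ k ∈ range L, f (Pi.single k 1) * y k) atTop (𝓝 (f y)) := by
  have hf0 : ∀ y, Tendsto y atTop (𝓝 0) → Tendsto (fun M => g M y) atTop (𝓝 (f y)) := by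
    intro y hy
    obtain ⟨B, hB⟩ := hy.norm.bddAbove_range
    exact hf y ⟨B, fun k => hB ⟨k, rfl⟩⟩
  have hB0 : 0 ≤ B := (norm_nonneg _).trans (hy 0)
  rw [Metric.tendsto_atTop]
  intro ε hε
  obtain ⟨K, hK⟩ := exists_tail_bound hg hf (show 0 < ε / (4 * (B + 1)) by positivity)
  refine ⟨K, fun L hL => ?_⟩
  have hB1 : ((B + 1 : ℝ) : ℂ) ≠ 0 := by exact_mod_cast (by positivity : B + 1 ≠ 0)
  set z : ℕ → ℂ := ((B + 1 : ℝ) : ℂ)⁻¹ • (y - head L y) with hz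
  have hz1 : ∀ k, ‖z k‖ ≤ 1 := by
    intro k
    have h : ‖(y - head L y) k‖ ≤ B := by
      by_cases hk : k < L
      · simpa [head, hk] using hB0
      · simpa [head, hk] using hy k
    rw [hz, Pi.smul_apply, norm_smul, norm_inv, Complex.norm_real,
      Real.norm_of_nonneg (by positivity), inv_mul_le_iff₀ (by positivity)]
    linarith
  have hzK := hK z hz1 fun k hk => by simp [hz, head, hk.trans_le hL]
  have hdecomp : f y = f (head L y) + ((B + 1 : ℝ) : ℂ) * f z := by
    refine tendsto_nhds_unique (hf y ⟨B, hy⟩) ?_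
    have h := (hf0 _ (tendsto_head L y)).add ((hf z ⟨1, hz1⟩).const_mul ((B + 1 : ℝ) : ℂ))
    refine h.congr fun M => ?_
    rw [hz, map_smul, smul_eq_mul, mul_inv_cancel_left₀ hB1, map_sub, add_sub_cancel]
  rw [dist_comm, dist_eq_norm, hdecomp, limit_head hf0, add_sub_cancel_left, norm_mul,
    Complex.norm_real, Real.norm_of_nonneg (by positivity)]
  calc (B + 1) * ‖f z‖ ≤ (B + 1) * (2 * (ε / (4 * (B + 1)))) := by gcongr
    _ = ε / 2 := by field_simp; ring
    _ < ε := by linarith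

end Limits

/-! ### Compact operators into `ℓ_1` -/

theorem LOne.summable_norm (v : LOne) : Summable fun n => ‖v n‖ := by
  simpa using (lp.memℓp v).summable (by simp)

theorem LOne.norm_eq_tsum (v : LOne) : ‖v‖ = ∑' n, ‖v n‖ := by
  simpa using lp.norm_eq_tsum_rpow (p := 1) (by simp) v

theorem LOne.sum_norm_le_norm (v : LOne) (N : Finset ℕ) : ∑ n ∈ N, ‖v n‖ ≤ ‖v‖ := by
  rw [LOne.norm_eq_tsum]
  exact (LOne.summable_norm v).sum_le_tsum N fun _ _ => norm_nonneg _

theorem LOne.norm_le_of_forall_sum_le {v : LOne} {c : ℝ} (h : ∀ N : Finset ℕ, ∑ n ∈ N, ‖v n‖ ≤ c) :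
    ‖v‖ ≤ c := by
  rw [LOne.norm_eq_tsum]
  exact (LOne.summable_norm v).tsum_le_of_sum_le h

/-- Split `s` by the sign of `v`: on each half the absolute sum is, up to sign, a subset sum. -/
theorem sum_abs_le_of_forall_abs_sum_le {ι : Type*} (s : Finset ι) (v : ι → ℝ) {c : ℝ}
    (h : ∀ t ⊆ s, |∑ i ∈ t, v i| ≤ c) : ∑ i ∈ s, |v i| ≤ 2 * c := by
  classical
  rw [← sum_filter_add_sum_filter_not s (fun i => 0 ≤ v i) fun i => |v i|]
  have h1 : ∑ i ∈ s with 0 ≤ v i, |v i| ≤ c := by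
    rw [sum_congr rfl fun i hi => abs_of_nonneg (mem_filter.1 hi).2]
    exact (le_abs_self _).trans (h _ (filter_subset _ _))
  have h2 : ∑ i ∈ s with ¬ 0 ≤ v i, |v i| ≤ c := by
    rw [sum_congr rfl fun i hi => abs_of_neg (not_le.1 (mem_filter.1 hi).2), sum_neg_distrib]
    exact (neg_le_abs _).trans (h _ (filter_subset _ _))
  linarith

theorem sum_norm_le_of_forall_norm_sum_le {ι : Type*} (s : Finset ι) (v : ι → ℂ) {c : ℝ}
    (h : ∀ t ⊆ s, ‖∑ i ∈ t, v i‖ ≤ c) : ∑ i ∈ s, ‖v i‖ ≤ 4 * c := by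
  have hre : ∑ i ∈ s, |(v i).re| ≤ 2 * c := sum_abs_le_of_forall_abs_sum_le s _ fun t ht => by
    rw [← Complex.re_sum]
    exact (Complex.abs_re_le_norm _).trans (h t ht)
  have him : ∑ i ∈ s, |(v i).im| ≤ 2 * c := sum_abs_le_of_forall_abs_sum_le s _ fun t ht => by
    rw [← Complex.im_sum]
    exact (Complex.abs_im_le_norm _).trans (h t ht)
  calc ∑ i ∈ s, ‖v i‖ ≤ ∑ i ∈ s, (|(v i).re| + |(v i).im|) :=
        sum_le_sum fun i _ => Complex.norm_le_abs_re_add_abs_im _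
    _ ≤ 4 * c := by rw [sum_add_distrib]; linarith

/-- The tails of the elements of a compact subset of `ℓ_1` are uniformly small. -/
theorem exists_forall_norm_sum_le_of_isCompact {K : Set LOne} (hK : IsCompact K) {ε : ℝ}
    (hε : 0 < ε) :
    ∃ r, ∀ N : Finset ℕ, (∀ n ∈ N, r ≤ n) → ∀ v ∈ K, ‖∑ n ∈ N, v n‖ ≤ ε := by
  -- Finitely many centres have a common tail index, and every point of `K` inherits it at the cost
  -- of `ε / 2`.
  obtain ⟨t, ht, hcov⟩ := Metric.totallyBounded_iff.1 hK.totallyBounded (ε / 2) (by positivity)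
  have htail : ∀ u : LOne, ∃ r, ∀ N : Finset ℕ, (∀ n ∈ N, r ≤ n) → ∑ n ∈ N, ‖u n‖ ≤ ε / 2 := by
    intro u
    obtain ⟨s, hs⟩ := summable_iff_vanishing_norm.1 (LOne.summable_norm u) (ε / 2) (by positivity)
    obtain ⟨r, hr⟩ := s.exists_nat_subset_range
    refine ⟨r, fun N hN => (le_abs_self _).trans (hs N ?_).le⟩
    refine disjoint_left.2 fun n hn hns => ?_
    exact (mem_range.1 (hr hns)).not_ge (hN n hn)
  choose r hr using htail
  obtain ⟨R, hR⟩ := (ht.image r).bddAbove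
  refine ⟨R, fun N hN v hv => ?_⟩
  obtain ⟨u, hu, huv⟩ := Set.mem_iUnion₂.1 (hcov hv)
  have h1 := hr u N fun n hn => (hR ⟨u, hu, rfl⟩).trans (hN n hn)
  have h2 := LOne.sum_norm_le_norm (v - u) N
  rw [Metric.mem_ball, dist_eq_norm] at huv
  calc ‖∑ n ∈ N, v n‖ ≤ ∑ n ∈ N, (‖(v - u) n‖ + ‖u n‖) :=
        norm_sum_le_of_le _ fun n _ => by
          calc ‖v n‖ = ‖(v - u) n + u n‖ := by rw [lp.coeFn_sub, Pi.sub_apply, sub_add_cancel]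
            _ ≤ _ := norm_add_le _ _
    _ ≤ ε := by rw [sum_add_distrib]; linarith

/-- The operator that keeps the first `r` coordinates of an element of `ℓ_1`. -/
def LOne.truncation (r : ℕ) : LOne →L[ℂ] LOne :=
  ∑ n ∈ range r, (lp.singleContinuousLinearMap ℂ (fun _ : ℕ => ℂ) 1 n).comp
    (lp.evalCLM ℂ (fun _ : ℕ => ℂ) 1 n)

theorem LOne.truncation_apply (r : ℕ) (v : LOne) (n : ℕ) :
    LOne.truncation r v n = if n < r then v n else 0 := by
  simp only [truncation, _root_.sum_apply, ContinuousLinearMap.comp_apply]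
  rw [lp.coeFn_sum, Finset.sum_apply]
  simp [lp.singleContinuousLinearMap_apply, lp.evalCLM, Pi.single_apply]

theorem LOne.isCompactOperator_truncation (r : ℕ) :
    IsCompactOperator (LOne.truncation r) := by
  have h : ∀ s : Finset ℕ, IsCompactOperator (⇑(∑ n ∈ s,
      (lp.singleContinuousLinearMap ℂ (fun _ : ℕ => ℂ) 1 n).comp
        (lp.evalCLM ℂ (fun _ : ℕ => ℂ) 1 n) : LOne →L[ℂ] LOne)) := by
    intro s
    induction s using Finset.induction_on with
    | empty =>
      rw [sum_empty]
      exact isCompactOperator_zero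
    | insert n s hn ih =>
      rw [sum_insert hn]
      refine IsCompactOperator.add ?_ ih
      have h1 : IsCompactOperator (lp.singleContinuousLinearMap ℂ (fun _ : ℕ => ℂ) 1 n) :=
        isCompactOperator_of_locallyCompactSpace_rng _
      exact h1.comp_clm (lp.evalCLM ℂ (fun _ : ℕ => ℂ) 1 n)
  exact h _

/-- An operator `T` into `ℓ_1` is compact if and only if the norms of the functionals
`∑_{n ∈ N} T_n` with `N ⊆ [r, ∞)` tend to `0` uniformly as `r → ∞`. Here `Φ N` stands for any
quantity equivalent to that norm. -/
theorem isCompactOperator_iff_tendsto {X : Type*} [NormedAddCommGroup X] [NormedSpace ℂ X]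
    (T : X →ₗ[ℂ] LOne) (Φ : Finset ℕ → ℝ≥0∞) (C : ℝ≥0∞) (hC : C ≠ ∞)
    (hle : ∀ N x, ‖∑ n ∈ N, T x n‖ₑ ≤ Φ N * ‖x‖ₑ)
    (hge : ∀ N c, (∀ x, ‖x‖ ≤ 1 → ‖∑ n ∈ N, T x n‖ₑ ≤ c) → Φ N ≤ C * c)
    (hfin : ∀ n, Φ {n} ≠ ∞) :
    IsCompactOperator T ↔
      Tendsto (fun r : ℕ => ⨆ (N : Finset ℕ) (_ : ∀ n ∈ N, r ≤ n), Φ N) atTop (𝓝 0) := by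
  constructor
  · intro hT
    obtain ⟨K, hK, hsub⟩ := hT.image_closedBall_subset_compact 1
    rw [ENNReal.tendsto_nhds_zero]
    intro ε hε
    obtain ⟨δ, hδ, hδε⟩ : ∃ δ : ℝ, 0 < δ ∧ C * ENNReal.ofReal δ ≤ ε := by
      have h : Tendsto (fun δ : ℝ => C * ENNReal.ofReal δ) (𝓝[>] 0) (𝓝 0) := by
        have h1 : Tendsto (fun δ : ℝ => ENNReal.ofReal δ) (𝓝[>] 0) (𝓝 0) := by
          have := (ENNReal.continuous_ofReal.tendsto 0).mono_left
            (nhdsWithin_le_nhds (s := Set.Ioi 0))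
          rwa [ENNReal.ofReal_zero] at this
        simpa using ENNReal.Tendsto.const_mul h1 (Or.inr hC)
      obtain ⟨δ, h1, h2⟩ :=
        ((ENNReal.tendsto_nhds_zero.1 h ε hε).and self_mem_nhdsWithin).exists
      exact ⟨δ, h2, h1⟩
    obtain ⟨r, hr⟩ := exists_forall_norm_sum_le_of_isCompact hK hδ
    filter_upwards [eventually_ge_atTop r] with r' hr'
    refine iSup₂_le fun N hN => (hge N _ fun x hx => ?_).trans hδε
    rw [← ofReal_norm]
    refine ENNReal.ofReal_le_ofReal (hr N (fun n hn => hr'.trans (hN n hn)) _ (hsub ⟨x, ?_, rfl⟩))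
    simpa using hx
  · intro h
    have htail : ∀ ε : ℝ, 0 < ε → ∃ r₀, ∀ r ≥ r₀, ∀ x, ∀ N : Finset ℕ, (∀ n ∈ N, r ≤ n) →
        ∑ n ∈ N, ‖T x n‖ ≤ 4 * (ε * ‖x‖) := by
      intro ε hε
      obtain ⟨r₀, hr₀⟩ := eventually_atTop.1
        (ENNReal.tendsto_nhds_zero.1 h (ENNReal.ofReal ε) (by simpa using hε))
      refine ⟨r₀, fun r hr x N hN => sum_norm_le_of_forall_norm_sum_le N _ fun t ht => ?_⟩
      have h1 : Φ t ≤ ENNReal.ofReal ε :=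
        (le_iSup₂ (f := fun (N : Finset ℕ) (_ : ∀ n ∈ N, r ≤ n) => Φ N) t
          fun n hn => hN n (ht hn)).trans (hr₀ r hr)
      have h2 := (hle t x).trans (mul_le_mul_left h1 ‖x‖ₑ)
      rw [← ofReal_norm, ← ofReal_norm, ← ENNReal.ofReal_mul hε.le] at h2
      exact (ENNReal.ofReal_le_ofReal_iff (by positivity)).1 h2
    have hcoord : ∀ n x, ‖T x n‖ ≤ (Φ {n}).toReal * ‖x‖ := by
      intro n x
      have h1 := hle {n} x
      rw [sum_singleton] at h1
      simpa using ENNReal.toReal_mono (ENNReal.mul_ne_top (hfin n) (by simp)) h1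
    -- Continuity of `T` is not given. It follows from bounds on the first `R` coordinates together
    -- with one uniform tail bound.
    obtain ⟨R, hR⟩ := htail 1 one_pos
    let T' : X →L[ℂ] LOne :=
      T.mkContinuous (∑ n ∈ range R, (Φ {n}).toReal + 4) fun x =>
        LOne.norm_le_of_forall_sum_le fun N => by
          rw [← sum_filter_add_sum_filter_not N (fun n => n < R), add_mul, sum_mul]
          refine add_le_add ?_ ?_
          · refine (sum_le_sum fun n _ => hcoord n x).trans ?_
            refine sum_le_sum_of_subset_of_nonneg ?_ fun n _ _ => by positivity
            intro n hn
            exact mem_range.2 (mem_filter.1 hn).2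
          · have := hR R le_rfl x {n ∈ N | ¬ n < R} fun n hn => not_lt.1 (mem_filter.1 hn).2
            simpa using this
    change IsCompactOperator T'
    refine isCompactOperator_of_tendsto (l := atTop)
      (F := fun r : ℕ => (LOne.truncation r).comp T') ?_
      (Eventually.of_forall fun r => (LOne.isCompactOperator_truncation r).comp_clm T')
    rw [Metric.tendsto_atTop]
    intro ε hε
    obtain ⟨r₀, hr₀⟩ := htail (ε / 8) (by positivity)
    refine ⟨r₀, fun r hr => ?_⟩
    rw [dist_eq_norm]
    refine (ContinuousLinearMap.opNorm_le_bound _ (M := ε / 2) (by positivity) fun x => ?_).trans_lt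
      (by linarith)
    refine LOne.norm_le_of_forall_sum_le fun N => ?_
    have hval : ∀ n, ‖(((LOne.truncation r).comp T' - T') x : LOne) n‖ =
        if r ≤ n then ‖T x n‖ else 0 := by
      intro n
      change ‖LOne.truncation r (T x) n - T x n‖ = _
      rw [LOne.truncation_apply]
      by_cases hn : n < r
      · simp [hn, hn.not_ge]
      · simp [hn, not_lt.1 hn]
    rw [sum_congr rfl fun n _ => hval n, ← sum_filter]
    refine (hr₀ r hr x _ fun n hn => (mem_filter.1 hn).2).trans (le_of_eq ?_)
    ring

/-! ### The inverse of the fractional difference operator -/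

theorem coeff_eq_choose (α : ℝ) (i : ℕ) : coeff α i = (-1) ^ i * Ring.choose α i := by
  have h : ∏ l ∈ range i, (α - l) = (i ! : ℝ) * Ring.choose α i := by
    rw [← nsmul_eq_mul, ← Ring.descPochhammer_eq_factorial_smul_choose,
      ← Polynomial.aeval_eq_smeval, Polynomial.aeval_def, Polynomial.eval₂_eq_eval_map,
      descPochhammer_map, descPochhammer_eval_eq_prod_range]
  rw [coeff, h]
  field_simp

/-- The generating function of the coefficients of the fractional difference of order `α`. -/
def diffSeries (α : ℝ) : PowerSeries ℂ := PowerSeries.mk fun i => (coeff α i : ℂ)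

/-- This is Chu–Vandermonde for `Ring.choose` with upper arguments `α` and `-α`, whose sum is `0`.
-/
theorem diffSeries_mul_neg (α : ℝ) : diffSeries α * diffSeries (-α) = 1 := by
  ext n
  have h : ∑ p ∈ antidiagonal n, coeff α p.1 * coeff (-α) p.2 = if n = 0 then 1 else 0 := by
    calc ∑ p ∈ antidiagonal n, coeff α p.1 * coeff (-α) p.2
        = ∑ p ∈ antidiagonal n, (-1) ^ n * (Ring.choose α p.1 * Ring.choose (-α) p.2) := by
          refine sum_congr rfl fun p hp => ?_
          rw [coeff_eq_choose, coeff_eq_choose, ← mem_antidiagonal.1 hp, pow_add]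
          ring
      _ = (-1) ^ n * Ring.choose (α + -α) n := by
          rw [Ring.add_choose_eq n (Commute.all _ _), mul_sum]
      _ = if n = 0 then 1 else 0 := by
          rw [add_neg_cancel, Ring.choose_zero_ite]
          split_ifs with h0 <;> simp [h0]
  rw [PowerSeries.coeff_mul, PowerSeries.coeff_one]
  simp only [diffSeries, PowerSeries.coeff_mk]
  have h' := congrArg (fun r : ℝ => (r : ℂ)) h
  push_cast at h'
  rw [h']
  split_ifs <;> simp

theorem transform_apply (α : ℝ) (y : ℕ → ℂ) (j : ℕ) :
    transform α y j = ∑ k ∈ range (j + 1), diffMatrix α j k * y k := rfl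

theorem mk_transform (α : ℝ) (y : ℕ → ℂ) :
    PowerSeries.mk (transform α y) = diffSeries α * PowerSeries.mk y := by
  ext n
  rw [mul_comm, PowerSeries.coeff_mul, PowerSeries.coeff_mk,
    Finset.Nat.sum_antidiagonal_eq_sum_range_succ_mk, transform_apply]
  refine sum_congr rfl fun k hk => ?_
  simp only [diffSeries, PowerSeries.coeff_mk, diffMatrix,
    if_pos (Nat.lt_succ_iff.1 (mem_range.1 hk))]
  ring

theorem transform_transform_neg (α : ℝ) (y : ℕ → ℂ) : transform α (transform (-α) y) = y := by
  have h : PowerSeries.mk (transform α (transform (-α) y)) = PowerSeries.mk y := by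
    rw [mk_transform, mk_transform, ← mul_assoc, diffSeries_mul_neg, one_mul]
  funext n
  simpa using congrArg (PowerSeries.coeff n) h

theorem transform_neg_transform (α : ℝ) (x : ℕ → ℂ) : transform (-α) (transform α x) = x := by
  simpa using transform_transform_neg (-α) x

theorem transform_single (α : ℝ) (k j : ℕ) :
    transform α (Pi.single k 1) j = diffMatrix α j k := by
  rw [transform_apply]
  by_cases hk : k ≤ j
  · simp [Pi.single_apply, hk]
  · simp [Pi.single_apply, hk, diffMatrix]

/-! ### The matrix transformation in terms of `y = Δ^(α) x` -/

variable {α : ℝ} {A : Matrix ℕ ℕ ℂ} {E : Submodule ℂ LInf}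

theorem hasSum_conditional_iff {f : ℕ → ℂ} {a : ℂ} :
    HasSum f a (SummationFilter.conditional ℕ) ↔
      Tendsto (fun n => ∑ k ∈ range n, f k) atTop (𝓝 a) := by
  rw [HasSum, SummationFilter.conditional_filter_eq_map_range, tendsto_map'_iff]
  rfl

/-- The partial sums of the series `A_n x` as functionals of `y = Δ^(α) x`. -/
def partialApply (α : ℝ) (A : Matrix ℕ ℕ ℂ) (n M : ℕ) : (ℕ → ℂ) →ₗ[ℂ] ℂ :=
  ∑ j ∈ range M, A n j • (LinearMap.proj j ∘ₗ transform (-α))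

theorem partialApply_apply (α : ℝ) (A : Matrix ℕ ℕ ℂ) (n M : ℕ) (y : ℕ → ℂ) :
    partialApply α A n M y = ∑ j ∈ range M, A n j * transform (-α) y j := by
  simp [partialApply]

theorem partialApply_congr (α : ℝ) (A : Matrix ℕ ℕ ℂ) (n M : ℕ) (y z : ℕ → ℂ)
    (h : ∀ k < M, y k = z k) : partialApply α A n M y = partialApply α A n M z := by
  rw [partialApply_apply, partialApply_apply]
  refine sum_congr rfl fun j hj => ?_
  rw [transform_apply, transform_apply]
  congr 1
  refine sum_congr rfl fun k hk => ?_
  rw [h k ((Nat.lt_succ_iff.1 (mem_range.1 hk)).trans_lt (mem_range.1 hj))]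

/-- `A_n x` as a function of `y = Δ^(α) x`. -/
def applyInv (α : ℝ) (A : Matrix ℕ ℕ ℂ) (n : ℕ) (y : ℕ → ℂ) : ℂ := apply A (transform (-α) y) n

theorem transform_neg_mem_domain {v : LInf} (hv : v ∈ E) : transform (-α) v ∈ domain α E :=
  ⟨v, hv, (transform_transform_neg α v).symm⟩

theorem tendsto_partialApply (hA : MapsToLOne A (domain α E)) (n : ℕ) {v : LInf} (hv : v ∈ E) :
    Tendsto (fun M => partialApply α A n M v) atTop (𝓝 (applyInv α A n v)) := by
  simp only [partialApply_apply]
  exact hasSum_conditional_iff.1 ((hA _ (transform_neg_mem_domain hv)).1 n).hasSum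

theorem tendsto_partialApply_of_tendsto_zero (hE : cZero ≤ E) (hA : MapsToLOne A (domain α E))
    (n : ℕ) (y : ℕ → ℂ) (hy : Tendsto y atTop (𝓝 0)) :
    Tendsto (fun M => partialApply α A n M y) atTop (𝓝 (applyInv α A n y)) :=
  tendsto_partialApply hA n (v := ⟨y, memℓp_infty_of_tendsto hy⟩) (hE hy)

theorem applyInv_single (α : ℝ) (A : Matrix ℕ ℕ ℂ) (n k : ℕ) :
    applyInv α A n (Pi.single k 1) = hat α A n k := by
  simp only [applyInv, apply, hat, transform_single, mul_comm]

theorem hatExists (hE : cZero ≤ E) (hA : MapsToLOne A (domain α E)) : HatExists α A := by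
  intro n k
  have h := tendsto_partialApply_of_tendsto_zero hE hA n _ (tendsto_single k)
  simp only [partialApply_apply, transform_single, mul_comm (A n _)] at h
  exact (hasSum_conditional_iff.2 h).summable

theorem summable_norm_hat (hE : cZero ≤ E) (hA : MapsToLOne A (domain α E)) (n : ℕ) :
    Summable fun k => ‖hat α A n k‖ := by
  simpa only [applyInv_single] using summable_norm_limit_single (partialApply_congr α A n)
    (tendsto_partialApply_of_tendsto_zero hE hA n)

theorem tendsto_sum_hat_of_tendsto_zero (hE : cZero ≤ E) (hA : MapsToLOne A (domain α E)) (n : ℕ)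
    {y : ℕ → ℂ} (hy : Tendsto y atTop (𝓝 0)) :
    Tendsto (fun L => ∑ k ∈ range L, hat α A n k * y k) atTop (𝓝 (applyInv α A n y)) := by
  simpa only [applyInv_single] using tendsto_sum_limit_single (partialApply_congr α A n)
    (tendsto_partialApply_of_tendsto_zero hE hA n) hy

theorem tendsto_sum_hat_of_bounded (hA : MapsToLOne A (domain α lInf)) (n : ℕ)
    {y : ℕ → ℂ} {B : ℝ} (hy : ∀ k, ‖y k‖ ≤ B) :
    Tendsto (fun L => ∑ k ∈ range L, hat α A n k * y k) atTop (𝓝 (applyInv α A n y)) := by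
  have h : ∀ y : ℕ → ℂ, (∃ B, ∀ k, ‖y k‖ ≤ B) →
      Tendsto (fun M => partialApply α A n M y) atTop (𝓝 (applyInv α A n y)) := by
    rintro y ⟨B, hB⟩
    have hb : BddAbove (Set.range fun k => ‖y k‖) := ⟨B, by rintro _ ⟨k, rfl⟩; exact hB k⟩
    exact tendsto_partialApply hA n (v := ⟨y, memℓp_infty hb⟩) trivial
  simpa only [applyInv_single] using
    tendsto_sum_limit_single_of_bounded (partialApply_congr α A n) h hy

theorem matrixOp_apply (hA : MapsToLOne A (domain α E)) (x : Space α E) (n : ℕ) :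
    matrixOp A hA x n = applyInv α A n (transform α (Space.seq x)) := by
  rw [applyInv, transform_neg_transform]
  rfl

theorem Space.norm_transform_le (x : Space α E) (k : ℕ) : ‖transform α (seq x) k‖ ≤ ‖x‖ :=
  lp.norm_apply_le_norm ENNReal.top_ne_zero (toLInf x) k

theorem Space.exists_transform_eq {v : LInf} (hv : v ∈ E) :
    ∃ x : Space α E, transform α (seq x) = v ∧ ‖x‖ = ‖v‖ := by
  let x : Space α E := ⟨transform (-α) v, transform_neg_mem_domain hv⟩
  have h : transform α (seq x) = v := transform_transform_neg α v
  have hx : toLInf x = v := Subtype.ext h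
  exact ⟨x, h, congrArg norm hx⟩

/-! ### Norms of the functionals `∑_{n ∈ N} A_n` -/

theorem hatSumNorm_singleton_ne_top (hE : cZero ≤ E) (hA : MapsToLOne A (domain α E)) (n : ℕ) :
    hatSumNorm α A {n} ≠ ∞ := by
  simp only [hatSumNorm, sum_singleton, ← ofReal_norm]
  exact (summable_norm_hat hE hA n).tsum_ofReal_ne_top

/-- The limits `G n` are left abstract because on `c` the series `∑_k â_{nk} y_k` tends to `A_n x +
l γ_n`, not to `A_n x`. -/
theorem enorm_sum_le_hatSumNorm_mul {G : ℕ → ℂ} {y : ℕ → ℂ} {B : ℝ≥0∞} (N : Finset ℕ)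
    (hG : ∀ n, Tendsto (fun L => ∑ k ∈ range L, hat α A n k * y k) atTop (𝓝 (G n)))
    (hy : ∀ k, ‖y k‖ₑ ≤ B) : ‖∑ n ∈ N, G n‖ₑ ≤ hatSumNorm α A N * B := by
  refine le_of_tendsto (tendsto_finsetSum N fun n _ => hG n).enorm (Eventually.of_forall fun L => ?_)
  rw [sum_comm]
  calc ‖∑ k ∈ range L, ∑ n ∈ N, hat α A n k * y k‖ₑ
      ≤ ∑ k ∈ range L, ‖∑ n ∈ N, hat α A n k‖ₑ * B := by
        refine (enorm_sum_le _ _).trans (sum_le_sum fun k _ => ?_)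
        rw [← sum_mul, enorm_mul]
        exact mul_le_mul_right (hy k) _
    _ ≤ hatSumNorm α A N * B := by
        rw [← sum_mul]
        exact mul_le_mul_left (ENNReal.sum_le_tsum _) _

theorem hatSumNorm_le (hE : cZero ≤ E) (hA : MapsToLOne A (domain α E)) {N : Finset ℕ} {c : ℝ≥0∞}
    (h : ∀ x : Space α E, ‖x‖ ≤ 1 → ‖∑ n ∈ N, matrixOp A hA x n‖ₑ ≤ c) :
    hatSumNorm α A N ≤ c := by
  refine ENNReal.tsum_le_of_sum_range_le fun L => ?_
  -- The finite sequence `head L u` lies in the unit ball of every admissible `E` and turns the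
  -- functional into a partial sum of `hatSumNorm`.
  choose u hu hbu using fun k => RCLike.exists_norm_eq_mul_self (∑ n ∈ N, hat α A n k)
  let v : LInf := ⟨head L u, memℓp_infty_of_tendsto (tendsto_head L u)⟩
  have hv : ‖v‖ ≤ 1 := lp.norm_le_of_forall_le zero_le_one (norm_head_le fun k => (hu k).le)
  obtain ⟨x, hx, hxn⟩ := Space.exists_transform_eq (α := α) (v := v) (hE (tendsto_head L u))
  have key : ∑ n ∈ N, matrixOp A hA x n =
      ((∑ k ∈ range L, ‖∑ n ∈ N, hat α A n k‖ : ℝ) : ℂ) := by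
    have h1 : ∀ n, matrixOp A hA x n = ∑ k ∈ range L, hat α A n k * u k := by
      intro n
      rw [matrixOp_apply, hx]
      simpa only [applyInv_single] using
        limit_head (tendsto_partialApply_of_tendsto_zero hE hA n) L u
    simp only [h1]
    rw [sum_comm, Complex.ofReal_sum]
    refine sum_congr rfl fun k _ => ?_
    rw [← sum_mul, mul_comm]
    exact (hbu k).symm
  have h2 := h x (hxn.trans_le hv)
  rw [key, ← ofReal_norm, Complex.norm_real, Real.norm_of_nonneg
    (sum_nonneg fun _ _ => norm_nonneg _), ENNReal.ofReal_sum_of_nonneg fun _ _ => norm_nonneg _]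
    at h2
  simpa only [ofReal_norm] using h2

theorem enorm_transform_le (x : Space α E) (k : ℕ) : ‖transform α (Space.seq x) k‖ₑ ≤ ‖x‖ₑ :=
  enorm_le_iff_norm_le.2 (Space.norm_transform_le x k)

theorem isCompactOperator_iff_hatSumNorm (hE : cZero ≤ E) (hA : MapsToLOne A (domain α E))
    (hsum : ∀ (x : Space α E) n, Tendsto
      (fun L => ∑ k ∈ range L, hat α A n k * transform α (Space.seq x) k) atTop
      (𝓝 (applyInv α A n (transform α (Space.seq x))))) :
    IsCompactOperator (matrixOp A hA) ↔
      Tendsto (fun r : ℕ => ⨆ (N : Finset ℕ) (_ : ∀ n ∈ N, r ≤ n), hatSumNorm α A N)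
        atTop (𝓝 0) := by
  refine isCompactOperator_iff_tendsto _ _ 1 ENNReal.one_ne_top (fun N x => ?_)
    (fun N c h => ?_) (hatSumNorm_singleton_ne_top hE hA)
  · simp only [matrixOp_apply]
    exact enorm_sum_le_hatSumNorm_mul N (hsum x) (enorm_transform_le x)
  · rw [one_mul]
    exact hatSumNorm_le hE hA h

/-! ### The space `c(Δ^(α))` -/

theorem cZero_le_cConv : cZero ≤ cConv := fun _ h => ⟨0, h⟩

theorem tail_eq (h : HatExists α A) {n m k : ℕ} (hk : k ≤ m) :
    tail α A n m k = hat α A n k - partialApply α A n m (Pi.single k 1) := by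
  rw [tail, if_pos hk]
  have h1 := hasSum_conditional_iff.1 (h n k).hasSum
  refine (hasSum_conditional_iff.2 ((h1.sub_const _).congr' ?_)).tsum_eq
  filter_upwards [eventually_ge_atTop m] with M hM
  simp only [partialApply_apply, transform_single, mul_comm (A n _)]
  rw [sum_ite, sum_const_zero, add_zero, sub_eq_iff_eq_add,
    ← sum_filter_add_sum_filter_not (range M) (fun j => m ≤ j)]
  congr 2
  ext j
  simp only [mem_filter, mem_range]
  omega

/-- Each tail is the full series minus a partial sum, so the row sum is a partial sum of `∑_k
â_{nk}` minus `partialApply` at the constant sequence `1`. Thus `γ_n` measures the failure of the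
series formula at `1`. -/
theorem tendsto_sum_tail (hA : MapsToLOne A (domain α cConv)) (n : ℕ) :
    Tendsto (fun m => ∑ k ∈ range (m + 1), tail α A n m k) atTop
      (𝓝 (∑' k, hat α A n k - applyInv α A n 1)) := by
  have hone : Tendsto (fun _ : ℕ => (1 : ℂ)) atTop (𝓝 1) := tendsto_const_nhds
  have h1 := (tendsto_add_atTop_iff_nat 1).2
    (summable_norm_hat cZero_le_cConv hA n).of_norm.tendsto_sum_tsum_nat
  have h2 := tendsto_partialApply hA n (v := ⟨1, memℓp_infty_of_tendsto hone⟩) ⟨1, hone⟩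
  refine (h1.sub h2).congr fun m => ?_
  change _ - partialApply α A n m 1 = _
  -- `partialApply` at `m` reads only `k < m`; expanding over `m + 1` coordinates adds a zero term
  -- and matches the range of the row sum.
  rw [triangular_apply (M := m + 1)
    (fun y z h => partialApply_congr α A n m y z fun k hk => h k (hk.trans m.lt_succ_self)) 1,
    ← sum_sub_distrib]
  refine sum_congr rfl fun k hk => ?_
  rw [tail_eq (hatExists cZero_le_cConv hA) (Nat.lt_succ_iff.1 (mem_range.1 hk)), Pi.one_apply,
    one_mul]

theorem gamExists (hA : MapsToLOne A (domain α cConv)) : GamExists α A :=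
  fun n => ⟨_, tendsto_sum_tail hA n⟩

theorem gam_eq (hA : MapsToLOne A (domain α cConv)) (n : ℕ) :
    gam α A n = ∑' k, hat α A n k - applyInv α A n 1 :=
  (tendsto_sum_tail hA n).limUnder_eq

theorem tendsto_sum_hat_of_tendsto (hA : MapsToLOne A (domain α cConv)) (n : ℕ)
    {y : ℕ → ℂ} {l : ℂ} (hy : Tendsto y atTop (𝓝 l)) :
    Tendsto (fun L => ∑ k ∈ range L, hat α A n k * y k) atTop
      (𝓝 (applyInv α A n y + l * gam α A n)) := by
  have hone : Tendsto (fun _ : ℕ => (1 : ℂ)) atTop (𝓝 1) := tendsto_const_nhds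
  have hz : Tendsto (y - l • (1 : ℕ → ℂ)) atTop (𝓝 0) := by
    have h := hy.sub (hone.const_mul l)
    rw [mul_one, sub_self] at h
    refine h.congr fun k => ?_
    simp
  have hsub : applyInv α A n (y - l • (1 : ℕ → ℂ)) =
      applyInv α A n y - l * applyInv α A n 1 := by
    refine tendsto_nhds_unique
      (tendsto_partialApply_of_tendsto_zero cZero_le_cConv hA n _ hz) ?_
    simp only [map_sub, map_smul, smul_eq_mul]
    exact (tendsto_partialApply hA n (v := ⟨y, memℓp_infty_of_tendsto hy⟩) ⟨l, hy⟩).sub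
      ((tendsto_partialApply hA n (v := ⟨1, memℓp_infty_of_tendsto hone⟩) ⟨1, hone⟩).const_mul l)
  have h1 := tendsto_sum_hat_of_tendsto_zero cZero_le_cConv hA n hz
  have h2 := (summable_norm_hat cZero_le_cConv hA n).of_norm.tendsto_sum_tsum_nat.const_mul l
  have h3 := h1.add h2
  rw [hsub] at h3
  rw [gam_eq hA]
  convert h3 using 2
  · rw [mul_sum, ← sum_add_distrib]
    refine sum_congr rfl fun k _ => ?_
    simp only [Pi.sub_apply, Pi.smul_apply, Pi.one_apply, smul_eq_mul]
    ring
  · ring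

/-- Evaluate at the `x` with `Δ^(α) x = 1`, which has norm at most `1`, and solve for `γ_n`. -/
theorem enorm_sum_gam_le (hA : MapsToLOne A (domain α cConv)) {N : Finset ℕ} {c : ℝ≥0∞}
    (h : ∀ x : Space α cConv, ‖x‖ ≤ 1 → ‖∑ n ∈ N, matrixOp A hA x n‖ₑ ≤ c) :
    ‖∑ n ∈ N, gam α A n‖ₑ ≤ hatSumNorm α A N + c := by
  have hone : Tendsto (fun _ : ℕ => (1 : ℂ)) atTop (𝓝 1) := tendsto_const_nhds
  let v : LInf := ⟨1, memℓp_infty_of_tendsto hone⟩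
  have hv : ‖v‖ ≤ 1 := lp.norm_le_of_forall_le zero_le_one fun k => by
    change ‖(1 : ℂ)‖ ≤ 1
    simp
  obtain ⟨x, hx, hxn⟩ := Space.exists_transform_eq (α := α) (v := v) (E := cConv) ⟨1, hone⟩
  have h1 := h x (hxn.trans_le hv)
  simp only [matrixOp_apply, hx] at h1
  have h2 : ‖∑ n ∈ N, ∑' k, hat α A n k‖ₑ ≤ hatSumNorm α A N * 1 := by
    refine enorm_sum_le_hatSumNorm_mul (y := 1) N (fun n => ?_) fun k => by simp
    simpa using (summable_norm_hat cZero_le_cConv hA n).of_norm.tendsto_sum_tsum_nat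
  rw [mul_one] at h2
  simp only [gam_eq hA, sum_sub_distrib]
  exact enorm_sub_le.trans (add_le_add h2 h1)

theorem enorm_sum_matrixOp_le (hA : MapsToLOne A (domain α cConv)) (N : Finset ℕ)
    (x : Space α cConv) : ‖∑ n ∈ N, matrixOp A hA x n‖ₑ ≤
      (hatSumNorm α A N + ‖∑ n ∈ N, gam α A n‖ₑ) * ‖x‖ₑ := by
  obtain ⟨l, hl⟩ := mem_domain_cConv.1 (Space.seq_mem x)
  have hlx : ‖l‖ₑ ≤ ‖x‖ₑ :=
    le_of_tendsto hl.enorm (Eventually.of_forall (enorm_transform_le x))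
  have h1 := enorm_sum_le_hatSumNorm_mul N (fun n => tendsto_sum_hat_of_tendsto hA n hl)
    (enorm_transform_le x)
  have h2 : ∑ n ∈ N, matrixOp A hA x n =
      ∑ n ∈ N, (applyInv α A n (transform α (Space.seq x)) + l * gam α A n) -
        l * ∑ n ∈ N, gam α A n := by
    simp only [matrixOp_apply]
    rw [sum_add_distrib, mul_sum, add_sub_cancel_right]
  rw [h2, add_mul, mul_comm ‖∑ n ∈ N, gam α A n‖ₑ]
  refine enorm_sub_le.trans (add_le_add h1 ?_)
  rw [enorm_mul]
  exact mul_le_mul_left hlx _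

theorem isCompactOperator_iff_hatSumNorm_add_gam (hA : MapsToLOne A (domain α cConv)) :
    IsCompactOperator (matrixOp A hA) ↔
      Tendsto (fun r : ℕ => ⨆ (N : Finset ℕ) (_ : ∀ n ∈ N, r ≤ n),
          (hatSumNorm α A N + ‖∑ n ∈ N, gam α A n‖ₑ))
        atTop (𝓝 0) := by
  -- The constant is 3: `hatSumNorm` is at most `c`, and the `γ` term at most `hatSumNorm + c`,
  -- hence `2c`.
  refine isCompactOperator_iff_tendsto _
    (fun N => hatSumNorm α A N + ‖∑ n ∈ N, gam α A n‖ₑ) 3 (by simp)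
    (enorm_sum_matrixOp_le hA) (fun N c h => ?_) fun n => ?_
  · have h1 := hatSumNorm_le cZero_le_cConv hA h
    calc hatSumNorm α A N + ‖∑ n ∈ N, gam α A n‖ₑ ≤ c + (c + c) :=
          add_le_add h1 ((enorm_sum_gam_le hA h).trans (by gcongr))
      _ = 3 * c := by ring
  · exact ENNReal.add_ne_top.2 ⟨hatSumNorm_singleton_ne_top cZero_le_cConv hA n, enorm_ne_top⟩

end FracDiff

end

open FracDiff in
theorem mainTheorem4 (α : ℝ) (A : Matrix ℕ ℕ ℂ) :
    (∀ hA : MapsToLOne A (domain α cZero),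
      HatExists α A ∧
      (IsCompactOperator (matrixOp A hA) ↔
        Tendsto (fun r : ℕ => ⨆ (N : Finset ℕ) (_ : ∀ n ∈ N, r ≤ n), hatSumNorm α A N)
          atTop (𝓝 0))) ∧
    (∀ hA : MapsToLOne A (domain α lInf),
      HatExists α A ∧
      (IsCompactOperator (matrixOp A hA) ↔
        Tendsto (fun r : ℕ => ⨆ (N : Finset ℕ) (_ : ∀ n ∈ N, r ≤ n), hatSumNorm α A N)
          atTop (𝓝 0))) ∧
    (∀ hA : MapsToLOne A (domain α cConv),
      HatExists α A ∧ GamExists α A ∧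
      (IsCompactOperator (matrixOp A hA) ↔
        Tendsto (fun r : ℕ => ⨆ (N : Finset ℕ) (_ : ∀ n ∈ N, r ≤ n),
            (hatSumNorm α A N + ‖∑ n ∈ N, gam α A n‖ₑ))
          atTop (𝓝 0))) := by
  refine ⟨fun hA => ?_, fun hA => ?_, fun hA => ?_⟩
  · exact ⟨hatExists le_rfl hA, isCompactOperator_iff_hatSumNorm le_rfl hA fun x n =>
      tendsto_sum_hat_of_tendsto_zero le_rfl hA n (mem_domain_cZero.1 (Space.seq_mem x))⟩
  · exact ⟨hatExists le_top hA, isCompactOperator_iff_hatSumNorm le_top hA fun x n =>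
      tendsto_sum_hat_of_bounded hA n (Space.norm_transform_le x)⟩
  · exact ⟨hatExists cZero_le_cConv hA, gamExists hA,
      isCompactOperator_iff_hatSumNorm_add_gam hA⟩
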